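/- Let $n,m\ge 1$, let $\mathbb{R}^n,\mathbb{R}^m$ carry the Euclidean scalar product and norm, let $f=(f_1,\dots,f_m)\colon\mathbb{R}^n\to\mathbb{R}^m$ be locally Lipschitz, and let $\Omega\subset\mathbb{R}^n$ be nonempty and closed. Write $a\leqq b$ if $b-a\in\mathbb{R}^m_+$. **Definitions.** For $A\subset\mathbb{R}^m$ and $y\in\mathbb{R}^m$ the section of $A$ at $y$ is $[A]_y:=A\cap(y-\mathbb{R}^m_+)$; it is called bounded if $[A]_y\subset a+\mathbb{R}^m_+$ for some $a\in\mathbb{R}^m$. For a set $S$ in a Euclidean space and $x\in S$, the regular normal cone $\widehat N(x;S)$ consists of all $v$ with $\langle v,z-x\rangle\le o(\|z-x\|)$ as $z\to x$, $z\in S$; the limiting normal cone $N(x;S)$ consists of all $v$ for which there are $x^k\to x$ with $x^k\in S$ and $v^k\to v$ with $v^k\in\widehat N(x^k;S)$. For $\phi\colon\mathbb{R}^n\to\mathbb{R}$ the limiting subdifferential is $\partial\phi(x):=\{v\in\mathbb{R}^n\mid (v,-1)\in N((x,\phi(x));\operatorname{epi}\phi)\}$, where $\operatorname{epi}\phi:=\{(x,t)\in\mathbb{R}^n\times\mathbb{R}\mid\phi(x)\le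 t\}$. For $x\in\Omega$ put $$\nu(x):=\inf\Big\{\Big\|\sum_{i=1}^m\lambda_iv^i+w\Big\|\ \Big|\ v^i\in\partial f_i(x)\cup\partial(-f_i)(x),\ w\in N(x;\Omega),\ \lambda\in\mathbb{R}^m_+,\ \sum_{i=1}^m\lambda_i=1\Big\},$$ and let $\Gamma(f,\Omega)$ be the set of all $x\in\Omega$ for which there are $v^i\in\partial f_i(x)\cup\partial(-f_i)(x)$ $(i=1,\dots,m)$ and $(\lambda,\mu)\in\mathbb{R}^m_+\times\mathbb{R}$ with $\sum_{i=1}^m\lambda_i+|\mu|=1$ and $0\in\sum_{i=1}^m\lambda_iv^i+\mu x+N(x;\Omega)$. Define - $\widetilde K_\infty(f,\Omega)$: the set of $y\in\mathbb{R}^m$ for which there is a sequence $\{x^k\}\subset\Omega$ with $\|x^k\|\to\infty$, $f(x^k)\to y$ and $\nu(x^k)\to0$; - $K_\infty(f,\Omega)$: the set of $y\in\mathbb{R}^m$ for which there is a sequence $\{x^k\}\subset\Omega$ with $\|x^k\|\to\infty$, $f(x^k)\to y$ and $\|x^k\|\,\nu(x^k)\to0$; - $T_\infty(f,\Omega)$: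 the set of $y\in\mathbb{R}^m$ for which there is a sequence $\{x^k\}\subset\Gamma(f,\Omega)$ with $\|x^k\|\to\infty$ and $f(x^k)\to y$. The restriction $f|_\Omega$ is proper if for every $y\in\mathbb{R}^m$ and every sequence $\{x^k\}\subset\Omega$ with $\|x^k\|\to\infty$ and $f(x^k)\leqq y$ for all $k$ one has $\|f(x^k)\|\to\infty$. **Statement.** Assume that every section of $f(\Omega)$ is bounded, i.e., $[f(\Omega)]_y$ is bounded for every $y\in\mathbb{R}^m$. Then the following assertions are equivalent: 1. $f|_\Omega$ is proper; 2. $f|_\Omega$ satisfies the Palais–Smale condition: $\widetilde K_\infty(f,\Omega)=\emptyset$; 3. $f|_\Omega$ satisfies the weak Palais–Smale condition: $K_\infty(f,\Omega)=\emptyset$; 4. $f|_\Omega$ is M-tame: $T_\infty(f,\Omega)=\emptyset$. Furthermore, if one of these equivalent conditions holds, then $[f(\Omega)]_y$ is compact for every $y\in\mathbb{R}^m$. -/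

import Mathlib

open Filter Topology

noncomputable section

namespace VectorOpt

/-- The Euclidean space `ℝⁿ` with its usual scalar product and norm. -/
abbrev Rn (n : ℕ) : Type := EuclideanSpace ℝ (Fin n)

section NormalsAndSubgradients

variable {E : Type*} [NormedAddCommGroup E] [InnerProductSpace ℝ E]

/-- The regular (Fréchet) normal cone to `S` at a point `x` of `S`: the vectors `v` with
`⟪v, z - x⟫ ≤ o(‖z - x‖)` as `z → x`, `z ∈ S`. -/
def regularNormalCone (S : Set E) (x : E) : Set E :=
  {v | ∀ ε : ℝ, 0 < ε → ∀ᶠ z in 𝓝[S] x, inner ℝ v (z - x) ≤ ε * ‖z - x‖}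

/-- The limiting (Mordukhovich) normal cone to `S` at a point `x` of `S`: limits of regular normals
at points of `S` converging to `x`. -/
def limitingNormalCone (S : Set E) (x : E) : Set E :=
  {v | ∃ (u : ℕ → E) (w : ℕ → E), (∀ k, u k ∈ S) ∧ Tendsto u atTop (𝓝 x) ∧
    (∀ k, w k ∈ regularNormalCone S (u k)) ∧ Tendsto w atTop (𝓝 v)}

/-- The epigraph of `φ`, in `E × ℝ` with its Hilbert space structure. -/
def epigraph (φ : E → ℝ) : Set (WithLp 2 (E × ℝ)) :=
  {p | φ p.fst ≤ p.snd}

/-- The limiting subdifferential: `v ∈ ∂φ(x)` iff `(v, -1)` is a limiting normal to the epigraph of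
`φ` at `(x, φ x)`. -/
def subdifferential (φ : E → ℝ) (x : E) : Set E :=
  {v | WithLp.toLp 2 (v, (-1 : ℝ)) ∈
    limitingNormalCone (epigraph φ) (WithLp.toLp 2 (x, φ x))}

end NormalsAndSubgradients

/-- The section `[A]_y = A ∩ (y - ℝᵐ₊)`. -/
def sectionAt {m : ℕ} (A : Set (Rn m)) (y : Rn m) : Set (Rn m) :=
  {z | z ∈ A ∧ ∀ i, z i ≤ y i}

/-- The section `[A]_y` is bounded: `[A]_y ⊆ a + ℝᵐ₊` for some `a`. -/
def SectionBounded {m : ℕ} (A : Set (Rn m)) (y : Rn m) : Prop :=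
  ∃ a : Rn m, ∀ z ∈ sectionAt A y, ∀ i, a i ≤ z i

variable {n m : ℕ}

/-- The restriction of `f` to `Ω` is proper at the sublevel `y`. -/
def ProperAtSublevel (f : Rn n → Rn m) (Ω : Set (Rn n)) (y : Rn m) : Prop :=
  ∀ x : ℕ → Rn n, (∀ k, x k ∈ Ω) → Tendsto (fun k => ‖x k‖) atTop atTop →
    (∀ k i, f (x k) i ≤ y i) → Tendsto (fun k => ‖f (x k)‖) atTop atTop

/-- The restriction of `f` to `Ω` is proper: it is proper at every sublevel. -/
def ProperOn (f : Rn n → Rn m) (Ω : Set (Rn n)) : Prop :=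
  ∀ y : Rn m, ProperAtSublevel f Ω y

/-- `∂f_i(x) ∪ ∂(-f_i)(x)`. -/
def symmSubdifferential (f : Rn n → Rn m) (i : Fin m) (x : Rn n) : Set (Rn n) :=
  subdifferential (fun z => f z i) x ∪ subdifferential (fun z => -(f z i)) x

/-- The (extended) Rabier function. For `x ∈ Ω`, `1 ≤ m` and `f` locally Lipschitz the infimum is
over a nonempty set of nonnegative reals. -/
def rabier (f : Rn n → Rn m) (Ω : Set (Rn n)) (x : Rn n) : ℝ :=
  sInf {r : ℝ | ∃ (v : Fin m → Rn n) (w : Rn n) (l : Fin m → ℝ),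
    (∀ i, v i ∈ symmSubdifferential f i x) ∧ w ∈ limitingNormalCone Ω x ∧
    (∀ i, 0 ≤ l i) ∧ ∑ i, l i = 1 ∧ r = ‖∑ i, l i • v i + w‖}

/-- `f(x) ≦ ȳ` for an extended vector `ȳ ∈ (ℝ ∪ {∞})ᵐ`. -/
def LeExt (z : Rn m) (ybar : Fin m → WithTop ℝ) : Prop :=
  ∀ i, ((z i : ℝ) : WithTop ℝ) ≤ ybar i

/-- The set `K̃_{∞,≦ȳ}(f,Ω)` of asymptotic critical values. -/
def KTildeInftyLe (f : Rn n → Rn m) (Ω : Set (Rn n)) (ybar : Fin m → WithTop ℝ) : Set (Rn m) :=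
  {y | ∃ x : ℕ → Rn n, (∀ k, x k ∈ Ω) ∧ (∀ k, LeExt (f (x k)) ybar) ∧
    Tendsto (fun k => ‖x k‖) atTop atTop ∧ Tendsto (fun k => f (x k)) atTop (𝓝 y) ∧
    Tendsto (fun k => rabier f Ω (x k)) atTop (𝓝 0)}

/-- The set `K_{∞,≦ȳ}(f,Ω)`. -/
def KInftyLe (f : Rn n → Rn m) (Ω : Set (Rn n)) (ybar : Fin m → WithTop ℝ) : Set (Rn m) :=
  {y | ∃ x : ℕ → Rn n, (∀ k, x k ∈ Ω) ∧ (∀ k, LeExt (f (x k)) ybar) ∧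
    Tendsto (fun k => ‖x k‖) atTop atTop ∧ Tendsto (fun k => f (x k)) atTop (𝓝 y) ∧
    Tendsto (fun k => ‖x k‖ * rabier f Ω (x k)) atTop (𝓝 0)}

/-- The set `Γ(f,Ω)`. -/
def tangencySet (f : Rn n → Rn m) (Ω : Set (Rn n)) : Set (Rn n) :=
  {x | x ∈ Ω ∧ ∃ (v : Fin m → Rn n) (l : Fin m → ℝ) (μ : ℝ),
    (∀ i, v i ∈ symmSubdifferential f i x) ∧ (∀ i, 0 ≤ l i) ∧ ∑ i, l i + |μ| = 1 ∧
    ∃ w ∈ limitingNormalCone Ω x, ∑ i, l i • v i + μ • x + w = 0}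

/-- The set `T_{∞,≦ȳ}(f,Ω)`. -/
def TInftyLe (f : Rn n → Rn m) (Ω : Set (Rn n)) (ybar : Fin m → WithTop ℝ) : Set (Rn m) :=
  {y | ∃ x : ℕ → Rn n, (∀ k, x k ∈ tangencySet f Ω) ∧ (∀ k, LeExt (f (x k)) ybar) ∧
    Tendsto (fun k => ‖x k‖) atTop atTop ∧ Tendsto (fun k => f (x k)) atTop (𝓝 y)}

/-- `K̃_∞(f,Ω)`: the case `ȳ = (∞, …, ∞)`. -/
def KTildeInfty (f : Rn n → Rn m) (Ω : Set (Rn n)) : Set (Rn m) :=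
  KTildeInftyLe f Ω (fun _ => ⊤)

/-- `K_∞(f,Ω)`: the case `ȳ = (∞, …, ∞)`. -/
def KInfty (f : Rn n → Rn m) (Ω : Set (Rn n)) : Set (Rn m) :=
  KInftyLe f Ω (fun _ => ⊤)

/-- `T_∞(f,Ω)`: the case `ȳ = (∞, …, ∞)`. -/
def TInfty (f : Rn n → Rn m) (Ω : Set (Rn n)) : Set (Rn m) :=
  TInftyLe f Ω (fun _ => ⊤)

/-- The Palais–Smale condition for the restriction of `f` to `Ω`. -/
def PalaisSmale (f : Rn n → Rn m) (Ω : Set (Rn n)) : Prop :=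
  KTildeInfty f Ω = ∅

/-- The weak Palais–Smale condition for the restriction of `f` to `Ω`. -/
def WeakPalaisSmale (f : Rn n → Rn m) (Ω : Set (Rn n)) : Prop :=
  KInfty f Ω = ∅

/-- M-tameness of the restriction of `f` to `Ω`. -/
def MTame (f : Rn n → Rn m) (Ω : Set (Rn n)) : Prop :=
  TInfty f Ω = ∅

end VectorOpt

end

/-! If `f` is proper on `Ω`, no sequence of `Ω` going to infinity can have convergent values, since
convergent values lie below a constant vector; this empties both `KTildeInfty` and `TInfty`.
Palais–Smale gives its weak form because the factor `‖x‖` is eventually at least 1.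

For the converses, scalarize by φ = `maxComponent f`. If properness fails, some set {x ∈ Ω : φ x ≤
c} is unbounded. For M-tameness, minimize φ on `Ω` intersected with spheres through such points: the
minimizers are tangency points with φ ≤ c (`tInfty_nonempty`). For weak Palais–Smale, let L be the
lower limit of φ at infinity on `Ω`; from a far point x with φ x < L + ε, minimize φ plus a
quadratic centred at x over a ball of radius `‖x‖ / 2`. The minimizer is interior, and the gradient
of the quadratic there bounds `‖z‖ * rabier f Ω z` by 18ε (`exists_mem_mul_rabier_le`). Bounded
sections make L finite and let the values converge along a subsequence.

Both minimizations rely on the multiplier rule `fritz_john`. It needs no sum or max rule for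
limiting subdifferentials: each `f i` gets its own copy of the variables on its epigraph, the
coupling is penalized quadratically, smooth first-order conditions are read off block by block, and
the normalized multipliers pass to the limit.

Compactness of sections holds because a section is the image of a sublevel set, which is closed and,
under properness, bounded. -/

namespace VectorOpt

/-! ### Regular and limiting normals. -/

section NormalCones

variable {E : Type*} [NormedAddCommGroup E] [InnerProductSpace ℝ E]

theorem neg_mem_regularNormalCone_of_isLocalMinOn {S : Set E} {x g : E} {ψ : E → ℝ}
    (hψ : HasFDerivAt ψ (innerSL ℝ g) x) (hmin : IsLocalMinOn ψ S x) :
    -g ∈ regularNormalCone S x := by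
  intro ε hε
  have h1 := nhdsWithin_le_nhds (s := S) (hψ.isLittleO.def hε)
  filter_upwards [h1, hmin] with z hz hz2
  simp only [innerSL_apply_apply, Real.norm_eq_abs] at hz
  have hz3 := (abs_le.1 hz).2
  rw [inner_neg_left]
  linarith

theorem smul_mem_regularNormalCone {S : Set E} {x v : E} (hv : v ∈ regularNormalCone S x)
    {c : ℝ} (hc : 0 ≤ c) : c • v ∈ regularNormalCone S x := by
  intro ε hε
  have hpos : 0 < ε / (c + 1) := by positivity
  filter_upwards [hv _ hpos] with z hz
  rw [real_inner_smul_left]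
  calc c * inner ℝ v (z - x) ≤ c * (ε / (c + 1) * ‖z - x‖) := by gcongr
    _ = (c / (c + 1)) * (ε * ‖z - x‖) := by ring
    _ ≤ 1 * (ε * ‖z - x‖) := by
      gcongr
      rw [div_le_one (by positivity)]
      linarith
    _ = ε * ‖z - x‖ := one_mul _

theorem inner_nonpos_of_mem_regularNormalCone {S : Set E} {x v d : E}
    (hv : v ∈ regularNormalCone S x) (hd : ∀ᶠ τ in 𝓝[>] (0 : ℝ), x + τ • d ∈ S) :
    inner ℝ v d ≤ 0 := by
  have key : ∀ ε : ℝ, 0 < ε → inner ℝ v d ≤ ε * ‖d‖ := by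
    intro ε hε
    have ht : Tendsto (fun τ : ℝ => x + τ • d) (𝓝[>] 0) (𝓝[S] x) := by
      refine tendsto_nhdsWithin_iff.2 ⟨?_, hd⟩
      refine Tendsto.mono_left ?_ nhdsWithin_le_nhds
      have : Continuous fun τ : ℝ => x + τ • d := by fun_prop
      simpa using this.tendsto 0
    obtain ⟨τ, hτ, hτ0⟩ := ((ht.eventually (hv ε hε)).and self_mem_nhdsWithin).exists
    have hτ0 : 0 < τ := hτ0
    rw [add_sub_cancel_left, real_inner_smul_right, norm_smul, Real.norm_of_nonneg hτ0.le] at hτ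
    refine le_of_mul_le_mul_left ?_ hτ0
    linarith
  refine le_of_forall_pos_le_add fun δ hδ => ?_
  have hpos : 0 < δ / (‖d‖ + 1) := by positivity
  have h1 := key _ hpos
  have h2 : δ / (‖d‖ + 1) * ‖d‖ ≤ δ := by
    rw [div_mul_eq_mul_div, div_le_iff₀ (by positivity)]
    nlinarith [norm_nonneg d]
  linarith

/-- Shifting the index turns conditions holding eventually into conditions holding for all `k`. -/
theorem mem_limitingNormalCone_of_eventually {S : Set E} {x v : E} {u w : ℕ → E}
    (hu : Tendsto u atTop (𝓝 x)) (hw : Tendsto w atTop (𝓝 v))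
    (h : ∀ᶠ k in atTop, u k ∈ S ∧ w k ∈ regularNormalCone S (u k)) :
    v ∈ limitingNormalCone S x := by
  obtain ⟨N, hN⟩ := eventually_atTop.1 h
  exact ⟨fun k => u (k + N), fun k => w (k + N), fun k => (hN _ (Nat.le_add_left _ _)).1,
    (tendsto_add_atTop_iff_nat N).2 hu, fun k => (hN _ (Nat.le_add_left _ _)).2,
    (tendsto_add_atTop_iff_nat N).2 hw⟩

theorem smul_mem_limitingNormalCone {S : Set E} {x v : E} (hv : v ∈ limitingNormalCone S x)
    {c : ℝ} (hc : 0 ≤ c) : c • v ∈ limitingNormalCone S x := by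
  obtain ⟨u, w, huS, hu, hwN, hw⟩ := hv
  exact ⟨u, fun k => c • w k, huS, hu, fun k => smul_mem_regularNormalCone (hwN k) hc,
    hw.const_smul c⟩

theorem hasFDerivAt_norm_sub_sq (a x : E) :
    HasFDerivAt (fun z => ‖z - a‖ ^ 2) (innerSL ℝ ((2 : ℝ) • (x - a))) x := by
  have h := ((hasFDerivAt_id x).sub_const a).norm_sq
  refine h.congr_fderiv ?_
  ext d
  simp

end NormalCones

/-! ### Normals to epigraphs and existence of subgradients. -/

section Epigraph

variable {E : Type*} [NormedAddCommGroup E] [InnerProductSpace ℝ E]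

/-- The epigraph contains the upward ray, so (0, 1) is a feasible direction. -/
theorem snd_nonneg_of_mem_regularNormalCone_epigraph {φ : E → ℝ} {x p : E} {t l : ℝ}
    (ht : φ x ≤ t)
    (h : WithLp.toLp 2 (p, -l) ∈ regularNormalCone (epigraph φ) (WithLp.toLp 2 (x, t))) :
    0 ≤ l := by
  have := inner_nonpos_of_mem_regularNormalCone (d := WithLp.toLp 2 ((0 : E), (1 : ℝ))) h ?_
  · simpa [WithLp.prod_inner_apply] using this
  · filter_upwards [self_mem_nhdsWithin] with τ hτ
    have hτ : 0 < τ := hτ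
    show φ (x + τ • (0 : E)) ≤ t + τ * 1
    rw [smul_zero, add_zero]
    linarith

/-- Strictly above the graph the downward direction (0, -1) is feasible too. -/
theorem snd_eq_zero_of_mem_regularNormalCone_epigraph {φ : E → ℝ} {x p : E} {t l : ℝ}
    (ht : φ x < t)
    (h : WithLp.toLp 2 (p, -l) ∈ regularNormalCone (epigraph φ) (WithLp.toLp 2 (x, t))) :
    l = 0 := by
  refine le_antisymm ?_ (snd_nonneg_of_mem_regularNormalCone_epigraph ht.le h)
  have := inner_nonpos_of_mem_regularNormalCone (d := WithLp.toLp 2 ((0 : E), (-1 : ℝ))) h ?_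
  · simpa [WithLp.prod_inner_apply] using this
  · filter_upwards [nhdsWithin_le_nhds (Iio_mem_nhds (sub_pos.2 ht))] with τ hτ
    have hτ : τ < t - φ x := hτ
    show φ (x + τ • (0 : E)) ≤ t + τ * (-1)
    rw [smul_zero, add_zero]
    linarith

/-- The Lipschitz bound makes (p, K‖p‖) a feasible direction; pairing it with the normal gives ‖p‖²
≤ K l ‖p‖. -/
theorem norm_fst_le_of_mem_regularNormalCone_epigraph {φ : E → ℝ} {x p : E} {t l : ℝ}
    {K : NNReal} {U : Set E} (hU : U ∈ 𝓝 x) (hφ : LipschitzOnWith K φ U) (ht : φ x ≤ t)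
    (h : WithLp.toLp 2 (p, -l) ∈ regularNormalCone (epigraph φ) (WithLp.toLp 2 (x, t))) :
    ‖p‖ ≤ K * l := by
  have hl := snd_nonneg_of_mem_regularNormalCone_epigraph ht h
  rcases (norm_nonneg p).eq_or_lt with hp | hp
  · rw [← hp]; positivity
  have := inner_nonpos_of_mem_regularNormalCone (d := WithLp.toLp 2 (p, (K * ‖p‖ : ℝ))) h ?_
  · simp only [WithLp.prod_inner_apply, real_inner_self_eq_norm_sq] at this
    simp only [RCLike.inner_apply, conj_trivial] at this
    refine le_of_mul_le_mul_left ?_ hp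
    nlinarith
  · have hc : Tendsto (fun τ : ℝ => x + τ • p) (𝓝[>] 0) (𝓝 x) := by
      refine Tendsto.mono_left ?_ nhdsWithin_le_nhds
      have : Continuous fun τ : ℝ => x + τ • p := by fun_prop
      simpa using this.tendsto 0
    filter_upwards [hc.eventually hU, self_mem_nhdsWithin] with τ hτU hτ
    have hτ : 0 < τ := hτ
    show φ (x + τ • p) ≤ t + τ * (K * ‖p‖)
    have h1 := hφ.dist_le_mul _ hτU _ (mem_of_mem_nhds hU)
    rw [Real.dist_eq, dist_eq_norm, add_sub_cancel_left, norm_smul, Real.norm_of_nonneg hτ.le] at h1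
    have h2 := (abs_le.1 h1).2
    nlinarith

/-- The smooth function (u, t) ↦ t + ψ u has a local minimum over the epigraph at the given point,
with gradient (g, 1). -/
theorem mem_regularNormalCone_epigraph_of_isLocalMin {φ ψ : E → ℝ} {x g : E}
    (hψ : HasFDerivAt ψ (innerSL ℝ g) x) (hmin : IsLocalMin (fun z => φ z + ψ z) x) :
    WithLp.toLp 2 (-g, (-1 : ℝ)) ∈
      regularNormalCone (epigraph φ) (WithLp.toLp 2 (x, φ x)) := by
  have h := neg_mem_regularNormalCone_of_isLocalMinOn (S := epigraph φ)
    (x := WithLp.toLp 2 (x, φ x)) (g := WithLp.toLp 2 (g, (1 : ℝ)))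
    (ψ := fun q => q.snd + ψ q.fst) ?_ ?_
  · rwa [← WithLp.toLp_neg, Prod.neg_mk] at h
  · have h1 : HasFDerivAt (fun q : WithLp 2 (E × ℝ) => ψ q.fst)
        ((innerSL ℝ g).comp (WithLp.fstL 2 ℝ E ℝ)) (WithLp.toLp 2 (x, φ x)) :=
      HasFDerivAt.comp (WithLp.toLp 2 (x, φ x)) (g := ψ) hψ
        (WithLp.fstL 2 ℝ E ℝ).hasFDerivAt
    have h2 : HasFDerivAt (fun q : WithLp 2 (E × ℝ) => q.snd)
        (WithLp.sndL 2 ℝ E ℝ) (WithLp.toLp 2 (x, φ x)) :=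
      (WithLp.sndL 2 ℝ E ℝ).hasFDerivAt
    refine (h2.add h1).congr_fderiv ?_
    ext d
    simp [WithLp.prod_inner_apply, add_comm]
  · have hc : Tendsto (fun q : WithLp 2 (E × ℝ) => q.fst)
        (𝓝[epigraph φ] WithLp.toLp 2 (x, φ x)) (𝓝 x) :=
      ((WithLp.fstL 2 ℝ E ℝ).continuous.tendsto (WithLp.toLp 2 (x, φ x))).mono_left
        nhdsWithin_le_nhds
    filter_upwards [hc.eventually hmin, self_mem_nhdsWithin] with q hq hqS
    have hqS : φ q.fst ≤ q.snd := hqS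
    change φ x + ψ x ≤ φ q.fst + ψ q.fst at hq
    show φ x + ψ x ≤ q.snd + ψ q.fst
    linarith

/-- Minimizers of φ + (k + 1)‖· - z‖² on a small ball tend to z, and the gradients of the quadratic
there stay bounded by 2K; a cluster point of their negatives is a subgradient. It serves the indices
with zero multiplier, which still require a subgradient. -/
theorem subdifferential_nonempty [ProperSpace E] {φ : E → ℝ} (hφ : LocallyLipschitz φ) (z : E) :
    (subdifferential φ z).Nonempty := by
  obtain ⟨K, U, hU, hK⟩ := hφ z
  obtain ⟨r, hr, hrU⟩ := Metric.nhds_basis_closedBall.mem_iff.1 hU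
  have hmin : ∀ k : ℕ, ∃ x ∈ Metric.closedBall z r,
      IsMinOn (fun u => φ u + ((k : ℝ) + 1) * ‖u - z‖ ^ 2) (Metric.closedBall z r) x := by
    intro k
    have hcont := hφ.continuous
    exact (isCompact_closedBall z r).exists_isMinOn ⟨z, Metric.mem_closedBall_self hr.le⟩
      (by fun_prop)
  choose x hxr hx using hmin
  have hbound : ∀ k : ℕ, ((k : ℝ) + 1) * ‖x k - z‖ ≤ K := by
    intro k
    have h1 : φ (x k) + ((k : ℝ) + 1) * ‖x k - z‖ ^ 2 ≤ φ z + ((k : ℝ) + 1) * ‖z - z‖ ^ 2 :=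
      hx k (Metric.mem_closedBall_self hr.le)
    have h2 := hK.dist_le_mul _ (hrU (hxr k)) _ (mem_of_mem_nhds hU)
    rw [Real.dist_eq, dist_eq_norm] at h2
    have h3 := (abs_le.1 h2).1
    rw [sub_self, norm_zero] at h1
    rcases (norm_nonneg (x k - z)).eq_or_lt with h0 | h0
    · rw [← h0, mul_zero]; exact K.2
    · refine le_of_mul_le_mul_left ?_ h0
      nlinarith
  have hxz : Tendsto x atTop (𝓝 z) := by
    rw [tendsto_iff_norm_sub_tendsto_zero]
    refine squeeze_zero (fun _ => norm_nonneg _) (fun k => ?_)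
      ((tendsto_const_div_atTop_nhds_zero_nat (K : ℝ)).comp (tendsto_add_atTop_nat 1))
    simp only [Function.comp_apply, Nat.cast_add, Nat.cast_one]
    rw [le_div_iff₀ (by positivity), mul_comm]
    exact hbound k
  have hnormal : ∀ᶠ k in atTop,
      WithLp.toLp 2 (-(((k : ℝ) + 1) • (2 : ℝ) • (x k - z)), (-1 : ℝ)) ∈
        regularNormalCone (epigraph φ) (WithLp.toLp 2 (x k, φ (x k))) := by
    filter_upwards [hxz.eventually (Metric.ball_mem_nhds z hr)] with k hk
    refine mem_regularNormalCone_epigraph_of_isLocalMin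
      (ψ := fun u => ((k : ℝ) + 1) * ‖u - z‖ ^ 2) ?_ ?_
    · have := (hasFDerivAt_norm_sub_sq z (x k)).const_mul ((k : ℝ) + 1)
      refine this.congr_fderiv ?_
      ext d
      simp
    · exact (hx k).isLocalMin (mem_of_superset (Metric.isOpen_ball.mem_nhds hk)
        Metric.ball_subset_closedBall)
  obtain ⟨v, -, σ, hσ, hv⟩ := tendsto_subseq_of_bounded
    (Metric.isBounded_closedBall (x := (0 : E)) (r := 2 * K))
    (x := fun k : ℕ => -(((k : ℝ) + 1) • (2 : ℝ) • (x k - z))) (by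
      intro k
      rw [mem_closedBall_zero_iff, norm_neg, norm_smul, norm_smul, Real.norm_of_nonneg
        (by positivity), Real.norm_of_nonneg (by norm_num)]
      linarith [hbound k])
  refine ⟨v, mem_limitingNormalCone_of_eventually
    (u := fun k => WithLp.toLp 2 (x (σ k), φ (x (σ k))))
    (w := fun k => WithLp.toLp 2 (-((((σ k : ℕ) : ℝ) + 1) • (2 : ℝ) • (x (σ k) - z)), (-1 : ℝ)))
    ?_ ?_ ?_⟩
  · have h1 := hxz.comp hσ.tendsto_atTop
    exact ((WithLp.prod_continuous_toLp 2 E ℝ).tendsto _).comp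
      (h1.prodMk_nhds ((hφ.continuous.tendsto z).comp h1))
  · exact ((WithLp.prod_continuous_toLp 2 E ℝ).tendsto _).comp
      (hv.prodMk_nhds tendsto_const_nhds)
  · filter_upwards [hσ.tendsto_atTop.eventually hnormal] with k hk
    exact ⟨le_refl (φ (x (σ k))), hk⟩

end Epigraph

end VectorOpt

namespace VectorOpt

/-! ### Quadratic penalization and its first-order conditions. -/

section MultiplierRule

variable {E : Type*} [NormedAddCommGroup E] {ι : Type*} [Fintype ι]

/-- The decoupled quadratic penalization of `s + g u` subject to `X i = u`, `T i = s`, `h u = 0`. -/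
def penalty (z : E) (g h : E → ℝ) (ρ : ℝ) (q : (ι → E) × (ι → ℝ) × E × ℝ) : ℝ :=
  q.2.2.2 + g q.2.2.1 + ‖q.2.2.1 - z‖ ^ 2 +
    ρ * (∑ i, (‖q.1 i - q.2.2.1‖ ^ 2 + (q.2.1 i - q.2.2.2) ^ 2) + h q.2.2.1 ^ 2)

/-- Tuples of points of the epigraphs of the `f i`, together with a point of `Ω` and a height. -/
def decoupledSet (f : ι → E → ℝ) (Ω : Set E) : Set ((ι → E) × (ι → ℝ) × E × ℝ) :=
  {q | (∀ i, f i (q.1 i) ≤ q.2.1 i) ∧ q.2.2.1 ∈ Ω}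

theorem isLocalMinOn_comp_of_mapsTo {Y Q : Type*} [TopologicalSpace Y] [TopologicalSpace Q]
    {F : Q → ℝ} {C : Set Q} {S : Set Y} {γ : Y → Q} {y : Y}
    (hF : IsLocalMinOn F C (γ y)) (hγ : Continuous γ) (hS : Set.MapsTo γ S C) :
    IsLocalMinOn (fun t => F (γ t)) S y :=
  IsMinFilter.comp_tendsto (g := γ) hF
    (tendsto_nhdsWithin_of_tendsto_nhds_of_eventually_within _
      ((hγ.tendsto y).mono_left nhdsWithin_le_nhds)
      (by filter_upwards [self_mem_nhdsWithin] with t ht using hS ht))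

/-- The height `s` is unconstrained, so the derivative of the penalty in `s` vanishes. -/
theorem sum_multipliers_eq_one {f : ι → E → ℝ} {Ω : Set E} {z : E} {g h : E → ℝ} {ρ : ℝ}
    {X : ι → E} {T : ι → ℝ} {u : E} {s : ℝ} (hq : (X, T, u, s) ∈ decoupledSet f Ω)
    (hmin : IsLocalMinOn (penalty z g h ρ) (decoupledSet f Ω) (X, T, u, s)) :
    ∑ i, 2 * ρ * (T i - s) = 1 := by
  have h1 : IsLocalMinOn (fun t => penalty z g h ρ (X, T, u, t)) Set.univ s :=
    isLocalMinOn_comp_of_mapsTo (γ := fun t => (X, T, u, t)) hmin (by fun_prop) fun _ _ => hq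
  rw [isLocalMinOn_univ_iff] at h1
  have h2 : HasDerivAt (fun t => penalty z g h ρ (X, T, u, t))
      (1 + ρ * ∑ i, 2 * (T i - s) * (-1)) s := by
    have h3 : ∀ i ∈ (Finset.univ : Finset ι), HasDerivAt
        (fun t => ‖X i - u‖ ^ 2 + (T i - t) ^ 2) (2 * (T i - s) * (-1)) s := by
      intro i _
      have h4 := (((hasDerivAt_id s).const_sub (T i)).pow 2).const_add (‖X i - u‖ ^ 2)
      refine h4.congr_deriv ?_
      simp
    exact ((((hasDerivAt_id s).add_const (g u)).add_const (‖u - z‖ ^ 2)).add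
      (((HasDerivAt.fun_sum h3).add_const (h u ^ 2)).const_mul ρ))
  have h5 := h1.hasDerivAt_eq_zero h2
  rw [← Finset.sum_mul] at h5
  have h6 : ∑ i, 2 * ρ * (T i - s) = ρ * ∑ i, 2 * (T i - s) := by
    rw [Finset.mul_sum]
    exact Finset.sum_congr rfl fun i _ => by ring
  rw [h6]
  linarith

/-- Minimize over a compact ball around the base point. Bounded values with `ρ → ∞` force limits to
satisfy the coupling constraints, and the term `‖u - z‖ ^ 2` then singles out the base point. The
ball constraint is therefore eventually inactive. -/
theorem exists_penalty_minimizers [ProperSpace E] {f : ι → E → ℝ} (hf : ∀ i, Continuous (f i))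
    {Ω : Set E} (hΩ : IsClosed Ω) {z : E} (hz : z ∈ Ω) {g h : E → ℝ} (hg : Continuous g)
    (hh : Continuous h) (hhz : h z = 0) {s₀ : ℝ} (hs₀ : ∀ i, f i z ≤ s₀)
    (hmin : ∀ᶠ x in 𝓝[Ω] z, h x = 0 → ∀ s, (∀ i, f i x ≤ s) → s₀ + g z ≤ s + g x) :
    ∃ (ρ : ℕ → ℝ) (q : ℕ → (ι → E) × (ι → ℝ) × E × ℝ),
      Tendsto q atTop (𝓝 (fun _ => z, fun _ => s₀, z, s₀)) ∧
      ∀ᶠ k in atTop, q k ∈ decoupledSet f Ω ∧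
        IsLocalMinOn (penalty z g h (ρ k)) (decoupledSet f Ω) (q k) := by
  obtain ⟨r, hr, hrmin⟩ := Metric.nhds_basis_closedBall.mem_iff.1
    (mem_nhdsWithin_iff_eventually.1 hmin)
  set q₀ : (ι → E) × (ι → ℝ) × E × ℝ := (fun _ => z, fun _ => s₀, z, s₀) with hq₀
  have hC : IsClosed (decoupledSet f Ω) := by
    have : decoupledSet f Ω = (⋂ i, {q | f i (q.1 i) ≤ q.2.1 i}) ∩ {q | q.2.2.1 ∈ Ω} := by
      ext q
      simp [decoupledSet]
    rw [this]
    refine (isClosed_iInter fun i => ?_).inter (hΩ.preimage (by fun_prop))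
    have := hf i
    exact isClosed_le (by fun_prop) (by fun_prop)
  have hcont : ∀ ρ : ℝ, Continuous (penalty (ι := ι) z g h ρ) := by
    intro ρ
    unfold penalty
    fun_prop
  set A := decoupledSet f Ω ∩ Metric.closedBall q₀ r with hA
  have hAc : IsCompact A := (isCompact_closedBall q₀ r).inter_left hC
  have hq₀C : q₀ ∈ decoupledSet f Ω := ⟨hs₀, hz⟩
  have hq₀A : q₀ ∈ A := ⟨hq₀C, Metric.mem_closedBall_self hr.le⟩
  have hval : ∀ ρ : ℝ, penalty z g h ρ q₀ = s₀ + g z := by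
    intro ρ
    simp [penalty, hq₀, hhz]
  have hex : ∀ k : ℕ, ∃ q ∈ A, IsMinOn (penalty z g h k) A q := fun k =>
    hAc.exists_isMinOn ⟨q₀, hq₀A⟩ (hcont k).continuousOn
  choose q hqA hq using hex
  obtain ⟨p, hpA, σ, hσ, hp⟩ := hAc.tendsto_subseq hqA
  set P : (ι → E) × (ι → ℝ) × E × ℝ → ℝ := fun q =>
    ∑ i, (‖q.1 i - q.2.2.1‖ ^ 2 + (q.2.1 i - q.2.2.2) ^ 2) + h q.2.2.1 ^ 2 with hP
  have hPc : Continuous P := by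
    rw [hP]
    fun_prop
  have hP0 : ∀ q, 0 ≤ P q := fun q => by positivity
  have hsplit : ∀ (ρ : ℝ) (q : (ι → E) × (ι → ℝ) × E × ℝ),
      penalty z g h ρ q = penalty z g h 0 q + ρ * P q := by
    intro ρ q
    simp only [penalty, hP]
    ring
  have hle : ∀ k : ℕ, penalty z g h 0 (q k) + k * P (q k) ≤ s₀ + g z := by
    intro k
    rw [← hsplit, ← hval k]
    exact hq k hq₀A
  have hp0 : penalty z g h 0 p ≤ s₀ + g z := by
    refine le_of_tendsto (((hcont 0).tendsto p).comp hp) (Eventually.of_forall fun k => ?_)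
    have := hle (σ k)
    have h2 : 0 ≤ ((σ k : ℕ) : ℝ) * P (q (σ k)) := mul_nonneg (Nat.cast_nonneg _) (hP0 _)
    simp only [Function.comp_apply]
    linarith
  have hPp : P p = 0 := by
    refine le_antisymm ?_ (hP0 p)
    by_contra hpos
    push Not at hpos
    obtain ⟨M, -, hM⟩ := hAc.exists_isMinOn ⟨q₀, hq₀A⟩ (hcont 0).continuousOn
    have h1 : Tendsto (fun k => ((σ k : ℕ) : ℝ) * P (q (σ k))) atTop atTop :=
      (tendsto_natCast_atTop_atTop.comp hσ.tendsto_atTop).atTop_mul_pos hpos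
        ((hPc.tendsto p).comp hp)
    obtain ⟨k, hk⟩ := (h1.eventually_gt_atTop (s₀ + g z - penalty z g h 0 M)).exists
    have h2 := hle (σ k)
    have h3 : penalty z g h 0 M ≤ penalty z g h 0 (q (σ k)) := hM (hqA _)
    linarith
  have hpq : p = q₀ := by
    obtain ⟨X, T, u, s⟩ := p
    simp only [hP] at hPp
    rw [add_eq_zero_iff_of_nonneg (by positivity) (by positivity),
      Finset.sum_eq_zero_iff_of_nonneg (fun i _ => by positivity)] at hPp
    obtain ⟨hXT, hhu⟩ := hPp
    have hX : ∀ i, X i = u ∧ T i = s := by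
      intro i
      have h1 := hXT i (Finset.mem_univ i)
      rw [add_eq_zero_iff_of_nonneg (by positivity) (by positivity)] at h1
      refine ⟨sub_eq_zero.1 (norm_eq_zero.1 (pow_eq_zero_iff two_ne_zero |>.1 h1.1)),
        sub_eq_zero.1 (pow_eq_zero_iff two_ne_zero |>.1 h1.2)⟩
    have hfu : ∀ i, f i u ≤ s := by
      intro i
      have h1 := hpA.1.1 i
      simpa only [(hX i).1, (hX i).2] using h1
    have hball : u ∈ Metric.closedBall z r := by
      have h1 : dist (X, T, u, s) q₀ ≤ r := hpA.2
      simp only [hq₀, Prod.dist_eq, max_le_iff] at h1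
      exact h1.2.2.1
    have h2 := hrmin hball hpA.1.2 (pow_eq_zero_iff two_ne_zero |>.1 hhu) s hfu
    -- The upper bound on the limit value and local minimality of `z` leave no room for `‖u - z‖ ^
    -- 2`.
    simp only [penalty, zero_mul, add_zero] at hp0
    have h3 : ‖u - z‖ ^ 2 = 0 := le_antisymm (by linarith) (by positivity)
    have hu : u = z := sub_eq_zero.1 (norm_eq_zero.1 (pow_eq_zero_iff two_ne_zero |>.1 h3))
    subst hu
    have hs : s = s₀ := by
      rw [h3] at hp0
      linarith
    subst hs
    simp only [hq₀, Prod.mk.injEq, and_true]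
    exact ⟨funext fun i => (hX i).1, funext fun i => (hX i).2⟩
  rw [hpq] at hp
  refine ⟨fun k => σ k, fun k => q (σ k), hp, ?_⟩
  filter_upwards [hp.eventually (Metric.ball_mem_nhds q₀ hr)] with k hk
  refine ⟨(hqA _).1, ?_⟩
  have h1 : IsLocalMinOn (penalty z g h (σ k)) A (q (σ k)) := (hq (σ k)).localize
  have hk : q (σ k) ∈ Metric.ball q₀ r := hk
  rwa [IsLocalMinOn, hA, nhdsWithin_inter_of_mem' (mem_nhdsWithin_of_mem_nhds
    (mem_of_superset (Metric.isOpen_ball.mem_nhds hk) Metric.ball_subset_closedBall))] at h1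

variable [InnerProductSpace ℝ E]

/-- When only the pair (X i, T i) moves, the penalty is `ρ` times its squared distance to (u, s), up
to a constant. -/
theorem mem_regularNormalCone_epigraph_of_penalty {f : ι → E → ℝ} {Ω : Set E} {z : E}
    {g h : E → ℝ} {ρ : ℝ} {X : ι → E} {T : ι → ℝ} {u : E} {s : ℝ}
    (hq : (X, T, u, s) ∈ decoupledSet f Ω)
    (hmin : IsLocalMinOn (penalty z g h ρ) (decoupledSet f Ω) (X, T, u, s)) (i : ι) :
    WithLp.toLp 2 ((2 * ρ) • (u - X i), -(2 * ρ * (T i - s))) ∈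
      regularNormalCone (epigraph (f i)) (WithLp.toLp 2 (X i, T i)) := by
  classical
  set γ : WithLp 2 (E × ℝ) → (ι → E) × (ι → ℝ) × E × ℝ :=
    fun q => (Function.update X i q.fst, Function.update T i q.snd, u, s) with hγ
  have hγ0 : γ (WithLp.toLp 2 (X i, T i)) = (X, T, u, s) := by simp [hγ]
  have hγc : Continuous γ := by
    have h1 : Continuous fun q : WithLp 2 (E × ℝ) => q.fst := (WithLp.fstL 2 ℝ E ℝ).continuous
    have h2 : Continuous fun q : WithLp 2 (E × ℝ) => q.snd := (WithLp.sndL 2 ℝ E ℝ).continuous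
    exact (continuous_const.update i h1).prodMk
      ((continuous_const.update i h2).prodMk continuous_const)
  have hmaps : Set.MapsTo γ (epigraph (f i)) (decoupledSet f Ω) := by
    intro q hqi
    refine ⟨fun j => ?_, hq.2⟩
    by_cases hj : j = i
    · subst hj
      simpa [hγ, epigraph] using hqi
    · simpa [hγ, hj] using hq.1 j
  have h1 : IsLocalMinOn (fun q => penalty z g h ρ (γ q)) (epigraph (f i))
      (WithLp.toLp 2 (X i, T i)) :=
    isLocalMinOn_comp_of_mapsTo (by rwa [hγ0]) hγc hmaps
  set c : ℝ := s + g u + ‖u - z‖ ^ 2 +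
    ρ * (∑ j ∈ Finset.univ.erase i, (‖X j - u‖ ^ 2 + (T j - s) ^ 2) + h u ^ 2) with hc
  have h2 : ∀ q, penalty z g h ρ (γ q) = ρ * ‖q - WithLp.toLp 2 (u, s)‖ ^ 2 + c := by
    intro q
    have h3 : ∑ j ∈ Finset.univ.erase i, (‖Function.update X i q.fst j - u‖ ^ 2 +
        (Function.update T i q.snd j - s) ^ 2) =
        ∑ j ∈ Finset.univ.erase i, (‖X j - u‖ ^ 2 + (T j - s) ^ 2) := by
      refine Finset.sum_congr rfl fun j hj => ?_
      have hj := Finset.ne_of_mem_erase hj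
      simp [hj]
    simp only [penalty, hγ]
    rw [← Finset.add_sum_erase _ _ (Finset.mem_univ i), h3, WithLp.prod_norm_sq_eq_of_L2, hc]
    simp only [Function.update_self, WithLp.sub_fst, WithLp.sub_snd, Real.norm_eq_abs, sq_abs,
      WithLp.toLp_fst, WithLp.toLp_snd]
    ring
  simp only [h2] at h1
  have h4 := ((hasFDerivAt_norm_sub_sq (WithLp.toLp 2 (u, s))
    (WithLp.toLp 2 (X i, T i))).const_mul ρ).add_const c
  have h5 := neg_mem_regularNormalCone_of_isLocalMinOn
    (g := ρ • (2 : ℝ) • (WithLp.toLp 2 (X i, T i) - WithLp.toLp 2 (u, s))) (h4.congr_fderiv ?_) h1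
  · convert h5 using 1
    rw [← WithLp.toLp_sub, ← WithLp.toLp_smul, ← WithLp.toLp_smul, ← WithLp.toLp_neg]
    congr 1
    ext
    · simp only [Prod.mk_sub_mk, Prod.smul_mk, Prod.neg_mk]
      module
    · simp only [Prod.mk_sub_mk, Prod.smul_mk, Prod.neg_mk, smul_eq_mul]
      ring
  · ext d
    simp

/-- Only `u` moves here, constrained to `Ω` alone. -/
theorem mem_regularNormalCone_of_penalty {f : ι → E → ℝ} {Ω : Set E} {z : E}
    {g h : E → ℝ} {g' h' : E → E} {ρ : ℝ} {X : ι → E} {T : ι → ℝ} {u : E} {s : ℝ}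
    (hg : HasFDerivAt g (innerSL ℝ (g' u)) u) (hh : HasFDerivAt h (innerSL ℝ (h' u)) u)
    (hq : (X, T, u, s) ∈ decoupledSet f Ω)
    (hmin : IsLocalMinOn (penalty z g h ρ) (decoupledSet f Ω) (X, T, u, s)) :
    -(g' u + (2 : ℝ) • (u - z) + ∑ i, (2 * ρ) • (u - X i) + (2 * ρ * h u) • h' u) ∈
      regularNormalCone Ω u := by
  have h1 : IsLocalMinOn (fun t => penalty z g h ρ (X, T, t, s)) Ω u :=
    isLocalMinOn_comp_of_mapsTo (γ := fun t => (X, T, t, s)) hmin (by fun_prop)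
      fun _ ht => ⟨hq.1, ht⟩
  refine neg_mem_regularNormalCone_of_isLocalMinOn ?_ h1
  have h3 : ∀ i ∈ (Finset.univ : Finset ι), HasFDerivAt
      (fun t => ‖X i - t‖ ^ 2 + (T i - s) ^ 2) (innerSL ℝ ((2 : ℝ) • (u - X i))) u := by
    intro i _
    simp only [norm_sub_rev (X i)]
    exact (hasFDerivAt_norm_sub_sq (X i) u).add_const _
  have h4 := ((hg.const_add s).add (hasFDerivAt_norm_sub_sq z u)).add
    (((HasFDerivAt.fun_sum h3).add (hh.pow 2)).const_mul ρ)
  refine h4.congr_fderiv ?_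
  ext d
  have h5 : ∀ i, ρ * (2 * (inner ℝ u d - inner ℝ (X i) d)) =
      2 * ρ * (inner ℝ u d - inner ℝ (X i) d) := fun i => by ring
  simp [Finset.mul_sum, h5]
  ring

end MultiplierRule

end VectorOpt

namespace VectorOpt

/-! ### Passage to the limit in the multipliers. -/

section LagrangeMultipliers

variable {E : Type*} [NormedAddCommGroup E] [InnerProductSpace ℝ E] [ProperSpace E]
  {ι : Type*} [Fintype ι]

/-- A limit of regular normals to the epigraph of a locally Lipschitz function is a nonnegative
multiple of a vector `(v, -1)` with `v` a subgradient. -/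
theorem exists_subgradient_of_tendsto {φ : E → ℝ} (hφ : LocallyLipschitz φ) {z p : E} {s₀ l : ℝ}
    (hs₀ : φ z ≤ s₀) {X P : ℕ → E} {T L : ℕ → ℝ} (hX : Tendsto X atTop (𝓝 z))
    (hT : Tendsto T atTop (𝓝 s₀)) (hP : Tendsto P atTop (𝓝 p)) (hL : Tendsto L atTop (𝓝 l))
    (hN : ∀ᶠ k in atTop, φ (X k) ≤ T k ∧ WithLp.toLp 2 (P k, -(L k)) ∈
      regularNormalCone (epigraph φ) (WithLp.toLp 2 (X k, T k))) :
    ∃ v ∈ subdifferential φ z, p = l • v := by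
  obtain ⟨K, U, hU, hK⟩ := hφ z
  have hl : 0 ≤ l := ge_of_tendsto hL <| by
    filter_upwards [hN] with k hk
    exact snd_nonneg_of_mem_regularNormalCone_epigraph hk.1 hk.2
  have hp : ‖p‖ ≤ K * l := by
    refine le_of_tendsto_of_tendsto hP.norm (hL.const_mul _) ?_
    filter_upwards [hN, hX.eventually (eventually_mem_nhds_iff.2 hU)] with k hk hkU
    exact norm_fst_le_of_mem_regularNormalCone_epigraph hkU hK hk.1 hk.2
  -- For `l = 0` the Lipschitz bound kills `p` and any subgradient works; for `l > 0` the limit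
  -- point must lie on the graph, as normals above it are horizontal.
  rcases hl.eq_or_lt with hl0 | hl0
  · obtain ⟨v, hv⟩ := subdifferential_nonempty hφ z
    rw [← hl0, mul_zero, norm_le_zero_iff] at hp
    exact ⟨v, hv, by rw [← hl0, hp, zero_smul]⟩
  · have hs : s₀ = φ z := by
      by_contra hne
      have hlt : φ z < s₀ := lt_of_le_of_ne hs₀ (Ne.symm hne)
      have hev : ∀ᶠ k in atTop, L k = 0 := by
        filter_upwards [hN, ((hφ.continuous.tendsto z).comp hX).eventually_lt hT hlt] with k hk hlt
        exact snd_eq_zero_of_mem_regularNormalCone_epigraph (x := X k) hlt hk.2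
      exact hl0.ne' (tendsto_nhds_unique hL
        (tendsto_const_nhds.congr' (hev.mono fun _ h => h.symm)))
    subst hs
    refine ⟨l⁻¹ • p, ?_, by rw [smul_smul, mul_inv_cancel₀ hl0.ne', one_smul]⟩
    have h1 : WithLp.toLp 2 (p, -l) ∈
        limitingNormalCone (epigraph φ) (WithLp.toLp 2 (z, φ z)) :=
      mem_limitingNormalCone_of_eventually
        (((WithLp.prod_continuous_toLp 2 E ℝ).tendsto _).comp (hX.prodMk_nhds hT))
        (((WithLp.prod_continuous_toLp 2 E ℝ).tendsto _).comp (hP.prodMk_nhds hL.neg)) hN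
    have h2 := smul_mem_limitingNormalCone h1 (inv_nonneg.2 hl)
    rw [← WithLp.toLp_smul, Prod.smul_mk, smul_neg, smul_eq_mul, inv_mul_cancel₀ hl0.ne'] at h2
    exact h2

/-- **Fritz John multiplier rule.** Let `z` minimize `max_i f i + g` locally over the points of `Ω`
with `h = 0`, where the `f i` are locally Lipschitz, `Ω` is closed, and `g`, `h` are continuously
differentiable. -/
theorem fritz_john {f : ι → E → ℝ} (hf : ∀ i, LocallyLipschitz (f i))
    {Ω : Set E} (hΩ : IsClosed Ω) {z : E} (hz : z ∈ Ω) {g h : E → ℝ} {g' h' : E → E}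
    (hg : ∀ x, HasFDerivAt g (innerSL ℝ (g' x)) x) (hg' : Continuous g')
    (hh : ∀ x, HasFDerivAt h (innerSL ℝ (h' x)) x) (hh' : Continuous h')
    (hhz : h z = 0) {s₀ : ℝ} (hs₀ : ∀ i, f i z ≤ s₀)
    (hmin : ∀ᶠ x in 𝓝[Ω] z, h x = 0 → ∀ s, (∀ i, f i x ≤ s) → s₀ + g z ≤ s + g x) :
    ∃ (v : ι → E) (w : E) (l : ι → ℝ) (μ : ℝ), (∀ i, v i ∈ subdifferential (f i) z) ∧
      w ∈ limitingNormalCone Ω z ∧ (∀ i, 0 ≤ l i) ∧ ∑ i, l i + |μ| = 1 ∧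
      ∑ i, l i • v i + (∑ i, l i) • g' z + μ • h' z + w = 0 ∧ ((∀ x, h x = 0) → μ = 0) := by
  have hgc : Continuous g := continuous_iff_continuousAt.2 fun x => (hg x).continuousAt
  have hhc : Continuous h := continuous_iff_continuousAt.2 fun x => (hh x).continuousAt
  obtain ⟨ρ, q, hq, hqmin⟩ := exists_penalty_minimizers (fun i => (hf i).continuous) hΩ hz hgc hhc
    hhz hs₀ hmin
  choose K U hU hK using fun i => hf i z
  have hX : ∀ i, Tendsto (fun k => (q k).1 i) atTop (𝓝 z) := fun i =>
    ((continuous_apply i).comp continuous_fst).tendsto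
      ((fun _ => z, fun _ => s₀, z, s₀) : (ι → E) × (ι → ℝ) × E × ℝ) |>.comp hq
  have hT : ∀ i, Tendsto (fun k => (q k).2.1 i) atTop (𝓝 s₀) := fun i =>
    (((continuous_apply i).comp continuous_fst).comp continuous_snd).tendsto
      ((fun _ => z, fun _ => s₀, z, s₀) : (ι → E) × (ι → ℝ) × E × ℝ) |>.comp hq
  have hu : Tendsto (fun k => (q k).2.2.1) atTop (𝓝 z) :=
    ((continuous_fst.comp continuous_snd).comp continuous_snd).tendsto
      ((fun _ => z, fun _ => s₀, z, s₀) : (ι → E) × (ι → ℝ) × E × ℝ) |>.comp hq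
  set M : ℕ → ℝ := fun k => 2 * ρ k * h (q k).2.2.1 with hM
  -- The multiplier `M` of the constraint `h = 0` may blow up. Scaling by `D` makes the total mass
  -- exactly 1, because the unscaled epigraph multipliers sum to 1.
  set D : ℕ → ℝ := fun k => (1 + |M k|)⁻¹ with hD
  set P : ℕ → ι → E := fun k i => D k • (2 * ρ k) • ((q k).2.2.1 - (q k).1 i) with hP
  set L : ℕ → ι → ℝ := fun k i => D k * (2 * ρ k * ((q k).2.1 i - (q k).2.2.2)) with hL
  have hD0 : ∀ k, 0 < D k := fun k => by positivity
  have hN : ∀ᶠ k in atTop, ∀ i, f i ((q k).1 i) ≤ (q k).2.1 i ∧ WithLp.toLp 2 (P k i, -(L k i)) ∈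
      regularNormalCone (epigraph (f i)) (WithLp.toLp 2 ((q k).1 i, (q k).2.1 i)) := by
    filter_upwards [hqmin] with k hk i
    refine ⟨hk.1.1 i, ?_⟩
    have h1 := smul_mem_regularNormalCone
      (mem_regularNormalCone_epigraph_of_penalty hk.1 hk.2 i) (hD0 k).le
    rwa [← WithLp.toLp_smul, Prod.smul_mk, smul_neg, smul_eq_mul] at h1
  have hLsum : ∀ᶠ k in atTop, ∑ i, L k i = D k := by
    filter_upwards [hqmin] with k hk
    rw [← Finset.mul_sum, sum_multipliers_eq_one hk.1 hk.2, mul_one]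
  have hsum : ∀ k, D k + |D k * M k| = 1 := by
    intro k
    rw [abs_mul, abs_of_pos (hD0 k)]
    have : 1 + |M k| ≠ 0 := by positivity
    simp only [hD]
    field_simp
  have hbdd : ∃ᶠ k in atTop, (P k, L k, D k * M k) ∈
      Metric.closedBall (0 : (ι → E) × (ι → ℝ) × ℝ) (∑ i, (K i : ℝ) + 1) := by
    have hUX : ∀ᶠ k in atTop, ∀ i, U i ∈ 𝓝 ((q k).1 i) :=
      eventually_all.2 fun i => (hX i).eventually (eventually_mem_nhds_iff.2 (hU i))
    refine Eventually.frequently ?_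
    filter_upwards [hN, hLsum, hUX] with k hk hk1 hkU
    have hK0 : 0 ≤ ∑ i, (K i : ℝ) := by positivity
    have hL0 : ∀ i, 0 ≤ L k i := fun i =>
      snd_nonneg_of_mem_regularNormalCone_epigraph (hk i).1 (hk i).2
    have hL1 : ∀ i, L k i ≤ 1 := fun i => by
      have h1 := Finset.single_le_sum (fun j _ => hL0 j) (Finset.mem_univ i)
      have h2 := hsum k
      have h3 := abs_nonneg (D k * M k)
      linarith
    rw [mem_closedBall_zero_iff, Prod.norm_def, Prod.norm_def]
    refine max_le ?_ (max_le ?_ ?_)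
    · refine (pi_norm_le_iff_of_nonneg (by positivity)).2 fun i => ?_
      have h1 := norm_fst_le_of_mem_regularNormalCone_epigraph (hkU i) (hK i) (hk i).1 (hk i).2
      have h2 : (K i : ℝ) ≤ ∑ j, (K j : ℝ) :=
        Finset.single_le_sum (f := fun j => (K j : ℝ)) (fun j _ => (K j).2) (Finset.mem_univ i)
      have h3 := mul_le_of_le_one_right (K i).2 (hL1 i)
      change ‖P k i‖ ≤ _
      have h4 : (K i : ℝ) * L k i ≤ K i := h3
      linarith
    · refine (pi_norm_le_iff_of_nonneg (by positivity)).2 fun i => ?_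
      change ‖L k i‖ ≤ _
      rw [Real.norm_of_nonneg (hL0 i)]
      linarith [hL1 i]
    · change |D k * M k| ≤ _
      linarith [hsum k, hD0 k]
  obtain ⟨⟨p, l, μ⟩, -, σ, hσ, hlim⟩ :=
    tendsto_subseq_of_frequently_bounded Metric.isBounded_closedBall hbdd
  have hσt := hσ.tendsto_atTop
  have hPlim : ∀ i, Tendsto (fun k => P (σ k) i) atTop (𝓝 (p i)) := fun i =>
    ((continuous_apply i).comp continuous_fst).tendsto
      ((p, l, μ) : (ι → E) × (ι → ℝ) × ℝ) |>.comp hlim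
  have hLlim : ∀ i, Tendsto (fun k => L (σ k) i) atTop (𝓝 (l i)) := fun i =>
    (((continuous_apply i).comp continuous_fst).comp continuous_snd).tendsto
      ((p, l, μ) : (ι → E) × (ι → ℝ) × ℝ) |>.comp hlim
  have hMlim : Tendsto (fun k => D (σ k) * M (σ k)) atTop (𝓝 μ) :=
    (continuous_snd.comp continuous_snd).tendsto
      ((p, l, μ) : (ι → E) × (ι → ℝ) × ℝ) |>.comp hlim
  have hDlim : Tendsto (fun k => D (σ k)) atTop (𝓝 (∑ i, l i)) :=
    (tendsto_finsetSum _ fun i _ => hLlim i).congr' (hσt.eventually hLsum)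
  have hsub : ∀ i, ∃ v ∈ subdifferential (f i) z, p i = l i • v := fun i =>
    exists_subgradient_of_tendsto (hf i) (hs₀ i) ((hX i).comp hσt) ((hT i).comp hσt) (hPlim i)
      (hLlim i) ((hσt.eventually hN).mono fun k hk => hk i)
  choose v hv hpv using hsub
  have hl0 : ∀ i, 0 ≤ l i := fun i => ge_of_tendsto (hLlim i) <| by
    filter_upwards [hσt.eventually hN] with k hk
    exact snd_nonneg_of_mem_regularNormalCone_epigraph (hk i).1 (hk i).2
  -- The vector `w` is defined by the multiplier equation; what remains is its normality, as a limit
  -- of scaled regular normals to `Ω`.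
  refine ⟨v, -(∑ i, l i • v i + (∑ i, l i) • g' z + μ • h' z), l, μ, hv, ?_, hl0, ?_,
    add_neg_cancel _, fun h0 => ?_⟩
  · have huσ := hu.comp hσt
    refine mem_limitingNormalCone_of_eventually huσ
      (w := fun k => -(∑ i, P (σ k) i + D (σ k) • (g' (q (σ k)).2.2.1 +
        (2 : ℝ) • ((q (σ k)).2.2.1 - z)) + (D (σ k) * M (σ k)) • h' (q (σ k)).2.2.1)) ?_ ?_
    · have h1 : Tendsto (fun k => g' (q (σ k)).2.2.1 + (2 : ℝ) • ((q (σ k)).2.2.1 - z)) atTop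
          (𝓝 (g' z)) := by
        have := ((hg'.tendsto z).comp huσ).add ((huσ.sub_const z).const_smul (2 : ℝ))
        rwa [sub_self, smul_zero, add_zero] at this
      have h2 := (((tendsto_finsetSum Finset.univ fun i _ => hPlim i).add (hDlim.smul h1)).add
        (hMlim.smul ((hh'.tendsto z).comp huσ))).neg
      simp only [hpv] at h2
      exact h2
    · filter_upwards [hσt.eventually hqmin] with k hk
      refine ⟨hk.1.2, ?_⟩
      change _ ∈ regularNormalCone Ω (q (σ k)).2.2.1
      have h1 := smul_mem_regularNormalCone
        (mem_regularNormalCone_of_penalty (hg _) (hh _) hk.1 hk.2) (hD0 (σ k)).le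
      convert h1 using 1
      simp only [hP, hM, smul_neg, smul_add, Finset.smul_sum, smul_smul]
      abel
  · exact tendsto_nhds_unique (hDlim.add hMlim.abs)
      (tendsto_const_nhds.congr fun k => (hsum (σ k)).symm)
  · refine tendsto_nhds_unique hMlim (tendsto_const_nhds.congr fun k => ?_)
    simp [hM, h0]

end LagrangeMultipliers

end VectorOpt

namespace VectorOpt

/-! ### Sublevel sets, scalarization and behaviour at infinity. -/

section Asymptotics

variable {n m : ℕ} {f : Rn n → Rn m} {Ω : Set (Rn n)}

theorem locallyLipschitz_apply (hf : LocallyLipschitz f) (i : Fin m) :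
    LocallyLipschitz fun x => f x i :=
  (EuclideanSpace.proj (𝕜 := ℝ) i : Rn m →L[ℝ] ℝ).lipschitz.locallyLipschitz.comp hf

theorem continuous_apply_of_locallyLipschitz (hf : LocallyLipschitz f) (i : Fin m) :
    Continuous fun x => f x i :=
  (locallyLipschitz_apply hf i).continuous

/-- The sublevel set `{x ∈ Ω | f x ≦ y}`. -/
def sublevel (f : Rn n → Rn m) (Ω : Set (Rn n)) (y : Rn m) : Set (Rn n) :=
  {x | x ∈ Ω ∧ ∀ i, f x i ≤ y i}

theorem exists_compact_of_sectionBounded {y : Rn m} (hsec : SectionBounded (f '' Ω) y) :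
    ∃ K : Set (Rn m), IsCompact K ∧ ∀ x ∈ sublevel f Ω y, f x ∈ K := by
  obtain ⟨a, ha⟩ := hsec
  refine ⟨WithLp.toLp 2 '' Set.Icc (fun i => a i) (fun i => y i),
    isCompact_Icc.image (PiLp.continuous_toLp 2 _), fun x hx => ?_⟩
  exact ⟨fun i => f x i, ⟨fun i => ha _ ⟨⟨x, hx.1, rfl⟩, hx.2⟩ i, hx.2⟩, rfl⟩

theorem isBounded_sublevel_of_properAtSublevel {y : Rn m} (hsec : SectionBounded (f '' Ω) y)
    (hp : ProperAtSublevel f Ω y) : Bornology.IsBounded (sublevel f Ω y) := by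
  by_contra hb
  rw [isBounded_iff_forall_norm_le] at hb
  push Not at hb
  choose x hx hxn using fun k : ℕ => hb k
  have h1 := hp x (fun k => (hx k).1)
    (tendsto_atTop_mono (fun k => (hxn k).le) tendsto_natCast_atTop_atTop) fun k => (hx k).2
  obtain ⟨K, hK, hfK⟩ := exists_compact_of_sectionBounded hsec
  obtain ⟨C, hC⟩ := hK.isBounded.exists_norm_le
  obtain ⟨k, hk⟩ := (h1.eventually_gt_atTop C).exists
  exact absurd (hC _ (hfK _ (hx k))) (not_le.2 hk)

/-- Properness is vacuous here: no sequence in a bounded sublevel set goes to infinity. -/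
theorem properAtSublevel_of_isBounded {y : Rn m} (hb : Bornology.IsBounded (sublevel f Ω y)) :
    ProperAtSublevel f Ω y := by
  intro x hxΩ hx hxy
  obtain ⟨C, hC⟩ := hb.exists_norm_le
  obtain ⟨k, hk⟩ := (hx.eventually_gt_atTop C).exists
  exact absurd (hC _ ⟨hxΩ k, hxy k⟩) (not_le.2 hk)

theorem isCompact_sectionAt_of_isBounded (hf : Continuous f) (hΩ : IsClosed Ω) {y : Rn m}
    (hb : Bornology.IsBounded (sublevel f Ω y)) : IsCompact (sectionAt (f '' Ω) y) := by
  have h1 : sectionAt (f '' Ω) y = f '' sublevel f Ω y := by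
    ext z
    constructor
    · rintro ⟨⟨x, hx, rfl⟩, hz⟩
      exact ⟨x, ⟨hx, hz⟩, rfl⟩
    · rintro ⟨x, ⟨hx, hz⟩, rfl⟩
      exact ⟨⟨x, hx, rfl⟩, hz⟩
  have h2 : IsClosed (sublevel f Ω y) := by
    have : sublevel f Ω y = Ω ∩ ⋂ i, {x | f x i ≤ y i} := by
      ext x
      simp [sublevel]
    rw [this]
    exact hΩ.inter (isClosed_iInter fun i => isClosed_le (by fun_prop) continuous_const)
  rw [h1]
  exact (Metric.isCompact_of_isClosed_isBounded h2 hb).image hf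

/-- Along a proper restriction no value can be approached at infinity. -/
theorem not_tendsto_of_properOn (hp : ProperOn f Ω) {x : ℕ → Rn n} (hxΩ : ∀ k, x k ∈ Ω)
    (hx : Tendsto (fun k => ‖x k‖) atTop atTop) (y : Rn m) :
    ¬ Tendsto (fun k => f (x k)) atTop (𝓝 y) := by
  intro hy
  obtain ⟨C, hC⟩ := hy.norm.bddAbove_range
  have hC : ∀ k, ‖f (x k)‖ ≤ C := fun k => hC ⟨k, rfl⟩
  have h1 := hp (WithLp.toLp 2 fun _ => C) x hxΩ hx fun k i =>
    (le_abs_self _).trans ((PiLp.norm_apply_le (f (x k)) i).trans (hC k))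
  obtain ⟨k, hk⟩ := (h1.eventually_gt_atTop C).exists
  exact absurd (hC k) (not_le.2 hk)

theorem rabier_nonneg (f : Rn n → Rn m) (Ω : Set (Rn n)) (x : Rn n) : 0 ≤ rabier f Ω x := by
  refine Real.sInf_nonneg ?_
  rintro r ⟨v, w, l, -, -, -, -, rfl⟩
  exact norm_nonneg _

theorem kInfty_subset_kTildeInfty (f : Rn n → Rn m) (Ω : Set (Rn n)) :
    KInfty f Ω ⊆ KTildeInfty f Ω := by
  rintro y ⟨x, hxΩ, hle, hx, hy, hr⟩
  refine ⟨x, hxΩ, hle, hx, hy, ?_⟩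
  refine squeeze_zero' (Eventually.of_forall fun k => rabier_nonneg f Ω (x k)) ?_ hr
  filter_upwards [hx.eventually_ge_atTop 1] with k hk
  exact le_mul_of_one_le_left (rabier_nonneg f Ω (x k)) hk

variable [NeZero m]

/-- The largest component of `f`. -/
def maxComponent (f : Rn n → Rn m) (x : Rn n) : ℝ :=
  Finset.univ.sup' Finset.univ_nonempty fun i => f x i

theorem maxComponent_le_iff {x : Rn n} {s : ℝ} : maxComponent f x ≤ s ↔ ∀ i, f x i ≤ s := by
  simp [maxComponent]

theorem le_maxComponent (f : Rn n → Rn m) (x : Rn n) (i : Fin m) : f x i ≤ maxComponent f x :=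
  maxComponent_le_iff.1 le_rfl i

theorem continuous_maxComponent (hf : LocallyLipschitz f) : Continuous (maxComponent f) :=
  Continuous.finset_sup'_apply Finset.univ_nonempty
    fun i _ => continuous_apply_of_locallyLipschitz hf i

/-- The sphere is the zero set of (‖x‖² - ‖z‖²)/2, whose gradient x produces the term μ x. -/
theorem mem_tangencySet_of_isMinOn_sphere (hf : LocallyLipschitz f) (hΩ : IsClosed Ω) {z : Rn n}
    (hz : z ∈ Ω) (hmin : IsMinOn (maxComponent f) (Ω ∩ Metric.sphere 0 ‖z‖) z) :
    z ∈ tangencySet f Ω := by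
  obtain ⟨v, w, l, μ, hv, hw, hl, hsum, heq, -⟩ := fritz_john (f := fun i x => f x i)
    (fun i => locallyLipschitz_apply hf i) hΩ hz (g := fun _ => 0) (g' := fun _ => 0)
    (h := fun x => (1 / 2) * ‖x - 0‖ ^ 2 - (1 / 2) * ‖z‖ ^ 2) (h' := fun x => x)
    (fun x => (hasFDerivAt_const (0 : ℝ) x).congr_fderiv (by simp)) continuous_const
    (fun x => (((hasFDerivAt_norm_sub_sq 0 x).const_mul (1 / 2)).sub_const _).congr_fderiv
      (by ext d; simp)) continuous_id (by simp) (le_maxComponent f z) (by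
      filter_upwards [self_mem_nhdsWithin] with x hx hhx s hs
      have h1 : ‖x‖ = ‖z‖ := by
        rw [sub_zero, sub_eq_zero] at hhx
        exact (sq_eq_sq₀ (norm_nonneg _) (norm_nonneg _)).1 (by linarith)
      have h2 : maxComponent f z ≤ maxComponent f x := hmin ⟨hx, by simp [h1]⟩
      linarith [maxComponent_le_iff.2 hs])
  refine ⟨hz, v, l, μ, fun i => Or.inl (hv i), hl, hsum, w, hw, ?_⟩
  simpa using heq

/-- With `h = 0` the multiplier μ vanishes and the `l i` sum to 1, so ∑ l i • v i + w = -g' z is a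
competitor in the infimum. -/
theorem rabier_le_of_isLocalMinOn (hf : LocallyLipschitz f) (hΩ : IsClosed Ω) {z : Rn n}
    (hz : z ∈ Ω) {g : Rn n → ℝ} {g' : Rn n → Rn n} (hg : ∀ x, HasFDerivAt g (innerSL ℝ (g' x)) x)
    (hg' : Continuous g') (hmin : IsLocalMinOn (fun x => maxComponent f x + g x) Ω z) :
    rabier f Ω z ≤ ‖g' z‖ := by
  obtain ⟨v, w, l, μ, hv, hw, hl, hsum, heq, hμ⟩ := fritz_john (f := fun i x => f x i)
    (fun i => locallyLipschitz_apply hf i) hΩ hz hg hg' (h := fun _ => 0) (h' := fun _ => 0)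
    (fun x => (hasFDerivAt_const (0 : ℝ) x).congr_fderiv (by simp)) continuous_const rfl
    (le_maxComponent f z) (by
      filter_upwards [hmin] with x hx _ s hs
      have := maxComponent_le_iff.2 hs
      linarith)
  have hμ0 := hμ fun _ => rfl
  rw [hμ0, abs_zero, add_zero] at hsum
  rw [hsum, one_smul, smul_zero, add_zero] at heq
  refine csInf_le ⟨0, ?_⟩ ⟨v, w, l, fun i => Or.inl (hv i), hw, hl, hsum, ?_⟩
  · rintro r ⟨v, w, l, -, -, -, -, rfl⟩
    exact norm_nonneg _
  · rw [← norm_neg]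
    congr 1
    rw [neg_eq_iff_add_eq_zero, ← heq]
    abel

theorem exists_subseq_tendsto_of_maxComponent_le (hsec : ∀ y, SectionBounded (f '' Ω) y) {c : ℝ}
    {x : ℕ → Rn n} (hxΩ : ∀ k, x k ∈ Ω) (hx : ∀ k, maxComponent f (x k) ≤ c) :
    ∃ (y : Rn m) (σ : ℕ → ℕ), StrictMono σ ∧ Tendsto (fun k => f (x (σ k))) atTop (𝓝 y) := by
  obtain ⟨K, hK, hfK⟩ := exists_compact_of_sectionBounded (hsec (WithLp.toLp 2 fun _ => c))
  obtain ⟨y, -, σ, hσ, hy⟩ := hK.tendsto_subseq (x := fun k => f (x k)) fun k =>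
    hfK _ ⟨hxΩ k, maxComponent_le_iff.1 (hx k)⟩
  exact ⟨y, σ, hσ, hy⟩

theorem tInfty_nonempty (hf : LocallyLipschitz f) (hΩ : IsClosed Ω)
    (hsec : ∀ y, SectionBounded (f '' Ω) y) {c : ℝ}
    (hunb : ∀ R : ℝ, ∃ x ∈ Ω, R ≤ ‖x‖ ∧ maxComponent f x ≤ c) : (TInfty f Ω).Nonempty := by
  have key : ∀ k : ℕ, ∃ z ∈ tangencySet f Ω, (k : ℝ) ≤ ‖z‖ ∧ maxComponent f z ≤ c := by
    intro k
    obtain ⟨x, hxΩ, hxk, hxc⟩ := hunb k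
    have hx : x ∈ Ω ∩ Metric.sphere 0 ‖x‖ := ⟨hxΩ, by simp⟩
    obtain ⟨z, hz, hmin⟩ := ((isCompact_sphere (0 : Rn n) ‖x‖).inter_left hΩ).exists_isMinOn
      ⟨x, hx⟩ (continuous_maxComponent hf).continuousOn
    have hzn : ‖z‖ = ‖x‖ := by simpa using hz.2
    refine ⟨z, mem_tangencySet_of_isMinOn_sphere hf hΩ hz.1 (by rwa [hzn]), hxk.trans hzn.ge,
      (hmin hx).trans hxc⟩
  choose z hzΓ hzk hzc using key
  obtain ⟨y, σ, hσ, hy⟩ := exists_subseq_tendsto_of_maxComponent_le hsec (fun k => (hzΓ k).1) hzc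
  refine ⟨y, fun k => z (σ k), fun k => hzΓ _, fun k i => le_top, ?_, hy⟩
  exact (tendsto_atTop_mono hzk tendsto_natCast_atTop_atTop).comp hσ.tendsto_atTop

/-- L is the lower limit of φ at infinity along `Ω`, taken as the supremum of the eventual lower
bounds. -/
theorem exists_lower_limit_at_infinity {φ : Rn n → ℝ} {b c : ℝ} (hb : ∀ x ∈ Ω, b ≤ φ x)
    (hunb : ∀ R : ℝ, ∃ x ∈ Ω, R ≤ ‖x‖ ∧ φ x ≤ c) :
    ∃ L : ℝ, ∀ ε > 0, (∃ R, ∀ x ∈ Ω, R ≤ ‖x‖ → L - ε ≤ φ x) ∧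
      ∀ R, ∃ x ∈ Ω, R ≤ ‖x‖ ∧ φ x < L + ε := by
  set A : Set ℝ := {a | ∃ R : ℝ, ∀ x ∈ Ω, R ≤ ‖x‖ → a ≤ φ x} with hA
  have hAb : BddAbove A := by
    refine ⟨c, ?_⟩
    rintro a ⟨R, hR⟩
    obtain ⟨x, hx, hxR, hxc⟩ := hunb R
    exact (hR x hx hxR).trans hxc
  have hAne : A.Nonempty := ⟨b, 0, fun x hx _ => hb x hx⟩
  refine ⟨sSup A, fun ε hε => ⟨?_, fun R => ?_⟩⟩
  · obtain ⟨a, ⟨R, hR⟩, ha⟩ := exists_lt_of_lt_csSup hAne (sub_lt_self (sSup A) hε)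
    exact ⟨R, fun x hx hxR => ha.le.trans (hR x hx hxR)⟩
  · by_contra! hcon
    have h1 : sSup A + ε ∈ A := ⟨R, hcon⟩
    linarith [le_csSup hAb h1]

/-- With r = ‖x‖/2, the quadratic equals 3ε on the boundary of the ball and its gradient is at most
6ε/r, while `‖z‖ ≤ 3 * r`. -/
theorem exists_mem_mul_rabier_le (hf : LocallyLipschitz f) (hΩ : IsClosed Ω) {ε R L : ℝ}
    (hε : 0 < ε) (hR : ∀ x ∈ Ω, R ≤ ‖x‖ → L - ε ≤ maxComponent f x) {x : Rn n} (hx : x ∈ Ω)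
    (hxR : 2 * R ≤ ‖x‖) (hx0 : 0 < ‖x‖) (hxL : maxComponent f x < L + ε) :
    ∃ z ∈ Ω, ‖x‖ / 2 ≤ ‖z‖ ∧ maxComponent f z < L + ε ∧ ‖z‖ * rabier f Ω z ≤ 18 * ε := by
  set r := ‖x‖ / 2 with hr
  have hr0 : 0 < r := by positivity
  set g : Rn n → ℝ := fun u => 3 * ε / r ^ 2 * ‖u - x‖ ^ 2 with hg
  have hgd : ∀ u, HasFDerivAt g (innerSL ℝ ((6 * ε / r ^ 2) • (u - x))) u := fun u =>
    ((hasFDerivAt_norm_sub_sq x u).const_mul (3 * ε / r ^ 2)).congr_fderiv (by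
      ext d
      simp
      ring)
  have hφ := continuous_maxComponent hf
  obtain ⟨z, hz, hmin⟩ := ((isCompact_closedBall x r).inter_left hΩ).exists_isMinOn
    (f := fun u => maxComponent f u + g u) ⟨x, hx, Metric.mem_closedBall_self hr0.le⟩
    (by rw [hg]; fun_prop)
  have hzr : ‖z - x‖ ≤ r := by simpa [dist_eq_norm] using hz.2
  have hzlow : r ≤ ‖z‖ := by
    have := norm_sub_norm_le x z
    rw [norm_sub_rev] at this
    linarith
  have hzup : ‖z‖ ≤ 3 * r := by
    have := norm_sub_norm_le z x
    linarith
  have hval : maxComponent f z + g z ≤ maxComponent f x := by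
    have : maxComponent f z + g z ≤ maxComponent f x + g x :=
      hmin ⟨hx, Metric.mem_closedBall_self hr0.le⟩
    simpa [hg] using this
  have hg0 : 0 ≤ g z := by positivity
  have hlow := hR z hz.1 (by linarith)
  -- On the boundary the perturbed value would be at least (L - ε) + 3ε, above its value at `x`,
  -- which is below L + ε.
  have hzlt : ‖z - x‖ < r := by
    refine lt_of_le_of_ne hzr fun heq => ?_
    have h1 : g z = 3 * ε := by
      simp only [hg, heq]
      field_simp
    linarith
  refine ⟨z, hz.1, hzlow, by linarith, ?_⟩
  have hloc : IsLocalMinOn (fun u => maxComponent f u + g u) Ω z := by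
    have h1 : IsLocalMinOn (fun u => maxComponent f u + g u) (Ω ∩ Metric.closedBall x r) z :=
      hmin.localize
    rwa [IsLocalMinOn, nhdsWithin_inter_of_mem' (mem_nhdsWithin_of_mem_nhds
      (mem_of_superset (Metric.isOpen_ball.mem_nhds (by simpa [dist_eq_norm] using hzlt))
        Metric.ball_subset_closedBall))] at h1
  have hrab := rabier_le_of_isLocalMinOn hf hΩ hz.1 hgd (by fun_prop) hloc
  rw [norm_smul, Real.norm_of_nonneg (by positivity)] at hrab
  calc ‖z‖ * rabier f Ω z ≤ (3 * r) * (6 * ε / r ^ 2 * r) := by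
        refine mul_le_mul hzup (hrab.trans ?_) (rabier_nonneg f Ω z) (by positivity)
        gcongr
    _ = 18 * ε := by
        field_simp
        norm_num

theorem kInfty_nonempty (hf : LocallyLipschitz f) (hΩ : IsClosed Ω)
    (hsec : ∀ y, SectionBounded (f '' Ω) y) {c : ℝ}
    (hunb : ∀ R : ℝ, ∃ x ∈ Ω, R ≤ ‖x‖ ∧ maxComponent f x ≤ c) : (KInfty f Ω).Nonempty := by
  obtain ⟨a, ha⟩ := hsec (WithLp.toLp 2 fun _ => c)
  -- Section boundedness controls only points with φ ≤ c; elsewhere c itself is a lower bound.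
  have hbelow : ∀ x ∈ Ω, min c (a 0) ≤ maxComponent f x := by
    intro x hx
    rcases le_total (maxComponent f x) c with h | h
    · exact (min_le_right _ _).trans
        ((ha _ ⟨⟨x, hx, rfl⟩, maxComponent_le_iff.1 h⟩ 0).trans (le_maxComponent f x 0))
    · exact (min_le_left _ _).trans h
  obtain ⟨L, hL⟩ := exists_lower_limit_at_infinity hbelow hunb
  have key : ∀ k : ℕ, ∃ z ∈ Ω, (k : ℝ) ≤ ‖z‖ ∧ maxComponent f z ≤ L + 1 ∧
      ‖z‖ * rabier f Ω z ≤ 18 * (1 / ((k : ℝ) + 1)) := by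
    intro k
    have hε : 0 < 1 / ((k : ℝ) + 1) := by positivity
    have hε1 : 1 / ((k : ℝ) + 1) ≤ 1 := by
      rw [div_le_one (by positivity)]
      linarith [(Nat.cast_nonneg k : (0 : ℝ) ≤ k)]
    obtain ⟨⟨R, hR⟩, hfar⟩ := hL _ hε
    -- The factor 2 compensates for `‖x‖ / 2 ≤ ‖z‖`; the `+ 1` keeps `‖x‖` positive when `k = 0`.
    obtain ⟨x, hx, hxR, hxL⟩ := hfar (max (2 * R) (2 * k + 1))
    rw [max_le_iff] at hxR
    have hk0 : (0 : ℝ) ≤ k := Nat.cast_nonneg k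
    obtain ⟨z, hz, hzx, hzL, hzr⟩ :=
      exists_mem_mul_rabier_le hf hΩ hε hR hx hxR.1 (by linarith) hxL
    exact ⟨z, hz, by linarith, by linarith, hzr⟩
  choose z hzΩ hzk hzL hzr using key
  obtain ⟨y, σ, hσ, hy⟩ := exists_subseq_tendsto_of_maxComponent_le hsec hzΩ hzL
  refine ⟨y, fun k => z (σ k), fun k => hzΩ _, fun k i => le_top, ?_, hy, ?_⟩
  · exact (tendsto_atTop_mono hzk tendsto_natCast_atTop_atTop).comp hσ.tendsto_atTop
  · have h1 : Tendsto (fun k : ℕ => 18 * (1 / ((k : ℝ) + 1))) atTop (𝓝 0) := by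
      simpa using (tendsto_one_div_add_atTop_nhds_zero_nat (𝕜 := ℝ)).const_mul 18
    exact (squeeze_zero (fun k => mul_nonneg (norm_nonneg _) (rabier_nonneg f Ω (z k)))
      hzr h1).comp hσ.tendsto_atTop

/-- Each vector sublevel set lies in the scalar one at height max_i y i, which the hypothesis makes
bounded. -/
theorem properOn_of_forall_exists_lt
    (h : ∀ c : ℝ, ∃ R : ℝ, ∀ x ∈ Ω, R ≤ ‖x‖ → c < maxComponent f x) : ProperOn f Ω := by
  intro y
  refine properAtSublevel_of_isBounded (isBounded_iff_forall_norm_le.2 ?_)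
  obtain ⟨R, hR⟩ := h (Finset.univ.sup' Finset.univ_nonempty fun i => y i)
  refine ⟨R, fun x hx => ?_⟩
  by_contra! hlt
  exact absurd (maxComponent_le_iff.2 fun i => (hx.2 i).trans
    (Finset.le_sup' (fun i => y i) (Finset.mem_univ i))) (not_le.2 (hR x hx.1 hlt.le))

end Asymptotics

end VectorOpt

/-! ### The equivalences and compactness of sections. -/

theorem corollary3p1 {n m : ℕ} (hm : 1 ≤ m)
    (f : VectorOpt.Rn n → VectorOpt.Rn m) (hf : LocallyLipschitz f)
    (Ω : Set (VectorOpt.Rn n)) (hΩne : Ω.Nonempty) (hΩ : IsClosed Ω)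
    (hsec : ∀ y : VectorOpt.Rn m, VectorOpt.SectionBounded (f '' Ω) y) :
    List.TFAE [VectorOpt.ProperOn f Ω, VectorOpt.PalaisSmale f Ω,
      VectorOpt.WeakPalaisSmale f Ω, VectorOpt.MTame f Ω] ∧
    ((VectorOpt.ProperOn f Ω ∨ VectorOpt.PalaisSmale f Ω ∨
      VectorOpt.WeakPalaisSmale f Ω ∨ VectorOpt.MTame f Ω) →
        ∀ y : VectorOpt.Rn m, IsCompact (VectorOpt.sectionAt (f '' Ω) y)) := by
  have : NeZero m := ⟨by omega⟩
  have h12 : VectorOpt.ProperOn f Ω → VectorOpt.PalaisSmale f Ω := by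
    intro hp
    refine Set.eq_empty_iff_forall_notMem.2 ?_
    rintro y ⟨x, hxΩ, -, hx, hy, -⟩
    exact VectorOpt.not_tendsto_of_properOn hp hxΩ hx y hy
  have h14 : VectorOpt.ProperOn f Ω → VectorOpt.MTame f Ω := by
    intro hp
    refine Set.eq_empty_iff_forall_notMem.2 ?_
    rintro y ⟨x, hxΓ, -, hx, hy⟩
    exact VectorOpt.not_tendsto_of_properOn hp (fun k => (hxΓ k).1) hx y hy
  have h23 : VectorOpt.PalaisSmale f Ω → VectorOpt.WeakPalaisSmale f Ω := fun h =>
    Set.subset_eq_empty (VectorOpt.kInfty_subset_kTildeInfty f Ω) h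
  have h31 : VectorOpt.WeakPalaisSmale f Ω → VectorOpt.ProperOn f Ω := by
    intro h
    refine VectorOpt.properOn_of_forall_exists_lt fun c => ?_
    by_contra! hcon
    exact (VectorOpt.kInfty_nonempty hf hΩ hsec hcon).ne_empty h
  have h41 : VectorOpt.MTame f Ω → VectorOpt.ProperOn f Ω := by
    intro h
    refine VectorOpt.properOn_of_forall_exists_lt fun c => ?_
    by_contra! hcon
    exact (VectorOpt.tInfty_nonempty hf hΩ hsec hcon).ne_empty h
  refine ⟨?_, fun h y => ?_⟩
  · tfae_have 1 → 2 := h12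
    tfae_have 2 → 3 := h23
    tfae_have 3 → 1 := h31
    tfae_have 1 → 4 := h14
    tfae_have 4 → 1 := h41
    tfae_finish
  · have hp : VectorOpt.ProperOn f Ω := by
      rcases h with h | h | h | h
      exacts [h, h31 (h23 h), h31 h, h41 h]
    exact VectorOpt.isCompact_sectionAt_of_isBounded hf.continuous hΩ
      (VectorOpt.isBounded_sublevel_of_properAtSublevel (hsec y) (hp y))
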